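/- **Domination.** An instance $C=(n,\mathbf p,\mathbf q)$ consists of $\mathbf p,\mathbf q\in[0,1]^n$ with $p_i\ge q_i$ for all $i$. A fair hidden bit $B$ is drawn; then independent bits $X_{i,j},Y_{i,j}$ ($i\le n$, $j\le r$) are drawn, with $X_{i,j}\sim\mathrm{Ber}(p_i)$, $Y_{i,j}\sim\mathrm{Ber}(q_i)$ if $B=0$, and $X_{i,j}\sim\mathrm{Ber}(q_i)$, $Y_{i,j}\sim\mathrm{Ber}(p_i)$ if $B=1$. A (randomized) algorithm sees $n$, $r$ and the samples, and succeeds if it outputs $B$. Let $r_{\min}(C,A,\rho)$ be the least integer $R\ge 0$ such that $A$ succeeds with probability at least $\rho$ for every $r\ge R$ ($\infty$ if there is none), let $r_{\min}(C,A)=r_{\min}(C,A,\tfrac34)$, and let $r_{\min}(C,\rho)=\inf_A r_{\min}(C,A,\rho)$ over all algorithms. Put $S_i=\sum_{j=1}^r(X_{i,j}-Y_{i,j})$. Here $\log$ is the logarithm to base $2$ and $\ln$ the natural logarithm. * $\mathcal A_{count}$ outputs $0$ if $\sum_iS_i>0$, $1$ if $\sum_i S_i<0$, and a fair coin if the sum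 is $0$. * $\mathcal A_{max}$ does the same with $S_{i'}$ in place of $\sum_i S_i$, where $i'$ maximizes $|S_i|$. * $\mathcal A_{coup}$, with error parameter $\alpha$, uses $\ell=\lceil 18\log(2n/\alpha)\rceil$ consecutive segments of $\lfloor r/\ell\rfloor$ samples each (the remaining samples are ignored). Let $S_{i,j}\in\{\pm1\}$ be the sign of $\sum_t (X_{i,t}-Y_{i,t})$ over the $j$-th segment, and let $i'$ maximize $|\sum_jS_{i,j}|$ and $Z_1=\sum_jS_{i',j}$. If $|Z_1|\ge\ell/3$, output $0$ if $Z_1>0$ and $1$ otherwise. If $|Z_1|<\ell/3$, let $T_j\in\{\pm1\}$ be the sign of $\sum_iS_{i,j}$ and $Z_2\in\{\pm1\}$ the sign of $\sum_jT_j$, and output $0$ if $Z_2=1$ and $1$ otherwise. A sign of zero is replaced by an independent fair $\pm1$ each time. Ties in the choice of the maximizer $i'$ may be broken by any fixed rule (a function of the list of values being compared); the statements below hold for every such rule, and the instances in 1 and 2 do not depend on it. **Statement.** 1. For each sufficiently large $n$ and every $0<\varepsilon\le 1$ there is an instance $C=(n,\mathbf p,\mathbf q)$ such that $\mathcal A_{coup}$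 with $\alpha=2/n$ satisfies $$r_{\min}\left(C,\mathcal A_{coup},1-\tfrac2n\right)\le\frac{5184\sqrt n\,\log n}{\varepsilon},\qquad\text{while}\qquad r_{\min}(C,\mathcal A_{count})\ge\frac{n}{16\varepsilon^2}.$$ 2. For each sufficiently large $n$ and every $0<\varepsilon<1/n^3$ there is an instance $C=(n,\mathbf p,\mathbf q)$ such that $\mathcal A_{coup}$ with $\alpha=2/n$ satisfies $$r_{\min}\left(C,\mathcal A_{coup},1-\tfrac2n\right)\le\frac{518400\sqrt n\,\ln n}{\varepsilon},\qquad\text{while}\qquad r_{\min}\left(C,\mathcal A_{max},\tfrac9{10}\right)\ge\frac{1}{\varepsilon^2\,2^{14}\ln n}.$$ 3. Consequently, for each fixed sufficiently large $n$ the competitive ratios of $\mathcal A_{count}$ and $\mathcal A_{max}$ are unbounded: for every $M$ there are instances $C$, $C'$ and $C''$ on $n$ coordinates with $r_{\min}(C,\mathcal A_{count},\tfrac34)>M\,r_{\min}(C,\tfrac34)$, with $r_{\min}(C',\mathcal A_{max},\tfrac34)>M\,r_{\min}(C',\tfrac34)$, and with $r_{\min}(C'',\mathcal A_{max},\tfrac9{10})>M\,r_{\min}(C'',\tfrac9{10})$.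 -/

import Mathlib

open scoped ENNReal

noncomputable section

namespace Domination

/-- An instance `(n, p, q)` of Domination: probability vectors with `1 ≥ p i ≥ q i ≥ 0`. -/
structure Inst (n : ℕ) where
  p : Fin n → ℝ
  q : Fin n → ℝ
  q_nonneg : ∀ i, 0 ≤ q i
  q_le_p : ∀ i, q i ≤ p i
  p_le_one : ∀ i, p i ≤ 1

/-- The samples `(X, Y)`: `X i j` and `Y i j` are bits, for `n` coordinates `i` and `r` draws `j`
(`true` is `1`, `false` is `0`). -/
abbrev Samples (n r : ℕ) : Type :=
  (Fin n → Fin r → Bool) × (Fin n → Fin r → Bool)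

/-- A (possibly randomized) algorithm for `n` coordinates: from the samples it produces a random
bit, its guess for `B` (`false` is `B = 0`, `true` is `B = 1`). -/
abbrev Algorithm (n : ℕ) : Type :=
  ∀ r : ℕ, Samples n r → PMF Bool

/-- The joint law of finitely many independent variables with laws `μ i`. -/
def indep {ι Ω : Type} [Fintype ι] [DecidableEq ι] [Fintype Ω] (μ : ι → PMF Ω) : PMF (ι → Ω) :=
  PMF.ofFintype (fun f => ∏ i, μ i (f i)) (by
    rw [← Fintype.prod_sum (fun i x => μ i x)]
    refine Finset.prod_eq_one fun i _ => ?_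
    exact (tsum_fintype (fun x => μ i x)).symm.trans (μ i).tsum_coe)

/-- The Bernoulli law with mean `a`, for `a ≤ 1` (and `a ≥ 0`). -/
def bern (a : ℝ) (ha : a ≤ 1) : PMF Bool :=
  PMF.ofFintype (fun b => if b then ENNReal.ofReal a else 1 - ENNReal.ofReal a) (by
    simp [add_tsub_cancel_of_le (ENNReal.ofReal_le_one.mpr ha)])

/-- Independent bits `Z i j`, `Z i j` being Bernoulli with mean `a i`. -/
def bits {n : ℕ} (r : ℕ) (a : Fin n → ℝ) (ha : ∀ i, a i ≤ 1) : PMF (Fin n → Fin r → Bool) :=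
  indep fun i => indep fun _ : Fin r => bern (a i) (ha i)

/-- The law of the samples given the hidden bit `B`. -/
def sampleLaw {n : ℕ} (C : Inst n) (r : ℕ) (B : Bool) : PMF (Samples n r) :=
  let P := bits r C.p C.p_le_one
  let Q := bits r C.q fun i => (C.q_le_p i).trans (C.p_le_one i)
  match B with
  | false => P.bind fun X => Q.bind fun Y => PMF.pure (X, Y)
  | true => Q.bind fun X => P.bind fun Y => PMF.pure (X, Y)

/-- The probability that `A`, given `r` samples, outputs the uniformly random hidden bit `B`. -/
def successProb {n : ℕ} (C : Inst n) (A : Algorithm n) (r : ℕ) : ℝ :=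
  (((PMF.uniformOfFintype Bool).bind fun B =>
    (sampleLaw C r B).bind fun x =>
      (A r x).map fun guess => guess == B) true).toReal

/-- `r_min(C, A, ρ)`: the least `R` such that for all `r ≥ R` the algorithm `A` succeeds with
probability at least `ρ` when given `r` samples (`∞` if there is none). -/
def rMin {n : ℕ} (C : Inst n) (A : Algorithm n) (ρ : ℝ) : ℝ≥0∞ :=
  ⨅ (R : ℕ) (_ : ∀ r : ℕ, R ≤ r → ρ ≤ successProb C A r), (R : ℝ≥0∞)

/-- `r_min(C, ρ)`: the infimum of `r_min(C, A, ρ)` over all algorithms. -/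
def rMinOpt {n : ℕ} (C : Inst n) (ρ : ℝ) : ℝ≥0∞ :=
  ⨅ A : Algorithm n, rMin C A ρ

/-- On `n` coordinates the competitive ratio `r_min(C, A, ρ) / r_min(C, ρ)` of `A` exceeds every
constant `M`. -/
def UnboundedRatio {n : ℕ} (A : Algorithm n) (ρ : ℝ) : Prop :=
  ∀ M : ℕ, ∃ C : Inst n, (M : ℝ≥0∞) * rMinOpt C ρ < rMin C A ρ

/-- The bit `b` as the integer `0` or `1`. -/
def bit (b : Bool) : ℤ := if b then 1 else 0

/-- `S i = ∑ j, (X i j - Y i j)`. -/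
def diffSum {n r : ℕ} (x : Samples n r) (i : Fin n) : ℤ :=
  ∑ j, (bit (x.1 i j) - bit (x.2 i j))

/-- Output `B = 0` if `Z > 0`, `B = 1` if `Z < 0`, and a fair coin if `Z = 0`. -/
def signGuess (Z : ℤ) : PMF Bool :=
  if 0 < Z then PMF.pure false
  else if Z < 0 then PMF.pure true
  else PMF.uniformOfFintype Bool

/-- The counting algorithm. -/
def countAlg (n : ℕ) : Algorithm n := fun _ x => signGuess (∑ i, diffSum x i)

/-- A way of computing `argmax_i |s i|`, that is, of breaking ties among the maximizers. -/
structure ArgmaxRule (n : ℕ) where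
  pick : (Fin n → ℤ) → Fin n
  isMax : ∀ (s : Fin n → ℤ) (i : Fin n), |s i| ≤ |s (pick s)|

theorem nonempty_argmaxRule (n : ℕ) [NeZero n] : Nonempty (ArgmaxRule n) := by
  have h : ∀ s : Fin n → ℤ, ∃ k, ∀ i, |s i| ≤ |s k| := fun s => Finite.exists_max fun i => |s i|
  choose f hf using h
  exact ⟨⟨f, hf⟩⟩

/-- The max algorithm. -/
def maxAlg {n : ℕ} (τ : ArgmaxRule n) : Algorithm n := fun _ x =>
  signGuess (diffSum x (τ.pick (diffSum x)))

/-- The sign of `d`, where a zero is replaced by `1` or `-1` according to a coin. -/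
def coinSign (d : ℤ) (coin : Bool) : ℤ :=
  if 0 < d then 1 else if d < 0 then -1 else if coin then 1 else -1

/-- The number `ℓ = 18 log₂ (2 n / α)` of segments, rounded up to an integer. -/
def numSegments (n : ℕ) (α : ℝ) : ℕ := ⌈18 * Real.logb 2 (2 * n / α)⌉₊

/-- The sum of `X i t - Y i t` over the `j`-th of `ℓ` consecutive segments, each of length
`⌊r / ℓ⌋`; the fewer than `ℓ` samples left over at the end are not used. -/
def segmentSum {n r : ℕ} (x : Samples n r) (ℓ : ℕ) (i : Fin n) (j : Fin ℓ) : ℤ :=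
  ∑ t : Fin r with j.val * (r / ℓ) ≤ t.val ∧ t.val < (j.val + 1) * (r / ℓ),
    (bit (x.1 i t) - bit (x.2 i t))

/-- The coins of the general coupling algorithm: one for each `S i j`, one for each `T j`,
one for `Z₂`. -/
abbrev Coins (n ℓ : ℕ) : Type := (Fin n → Fin ℓ → Bool) × (Fin ℓ → Bool) × Bool

/-- The output of the general coupling algorithm with `ℓ` segments when its coins are `c`. -/
def coupOutput {n r : ℕ} (τ : ArgmaxRule n) (ℓ : ℕ) (x : Samples n r) (c : Coins n ℓ) : Bool :=
  let S : Fin n → Fin ℓ → ℤ := fun i j => coinSign (segmentSum x ℓ i j) (c.1 i j)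
  let V : Fin n → ℤ := fun i => ∑ j, S i j
  let Z₁ : ℤ := V (τ.pick V)
  let T : Fin ℓ → ℤ := fun j => coinSign (∑ i, S i j) (c.2.1 j)
  let Z₂ : ℤ := coinSign (∑ j, T j) c.2.2
  if (ℓ : ℝ) / 3 ≤ |(Z₁ : ℝ)| then
    (if 0 < Z₁ then false else true)
  else
    (if 0 < Z₂ then false else true)

/-- The general coupling algorithm with error parameter `α`; its coins are fair and independent. -/
def coupAlg {n : ℕ} (τ : ArgmaxRule n) (α : ℝ) : Algorithm n := fun _ x =>
  (PMF.uniformOfFintype (Coins n (numSegments n α))).map (coupOutput τ (numSegments n α) x)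

end Domination

end

open scoped ENNReal

noncomputable section

namespace Domination

/-! Both lower bounds use `noisyInst`: one coordinate `i₀` with `p = ε` and `q = 0`, fair coins on a
set `I`, and zeros elsewhere. Against counting, `I` consists of all other coordinates; against the
max algorithm, of a single one.

The evidence in `i₀` is one-sided: its sum never has the wrong sign. Once every segment contains a
success of `i₀`, all `ℓ` of its signs are correct, whereas a coordinate with `p = q` has symmetric
signs, which all agree with probability at most `2 / 2 ^ ℓ`. Then `i₀` is the unique maximizer. By a
union bound the coupling algorithm errs with probability at most `ℓ (1 - ε) ^ ⌊r / ℓ⌋ + 2 n / 2 ^ ℓ`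
(`coupAlg_success`), so for fixed `n` order `1 / ε` samples suffice.

The `2 k` fair bits of `I`, with `k = |I| r`, fluctuate by order `√k`, while the sum of `i₀` has
mean `r ε`. As long as `r ε` is a small multiple of `√k`, the noise outweighs `i₀` in the wrong
direction with probability above `1 / 4` (`le_sum_sampleWeight_noise`, `successProb_lt`). This
persists up to `r` of order `|I| / ε ^ 2`, and `ε → 0` makes the ratios unbounded.

Both probability estimates are symmetry arguments: averaging over weight-preserving involutions
reduces them to counting subsets. -/

/-- The probability of the bit `b` under the Bernoulli law with mean `a`. -/
def bernWeight (a : ℝ) (b : Bool) : ℝ := if b then a else 1 - a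

/-- The probability of the array `X` under the law `bits r a`. -/
def bitsWeight {n r : ℕ} (a : Fin n → ℝ) (X : Fin n → Fin r → Bool) : ℝ :=
  ∏ i, ∏ t, bernWeight (a i) (X i t)

/-- The probability of the samples `x` when the `X i t` have means `p i` and the `Y i t` have
means `q i`. -/
def sampleWeight {n r : ℕ} (p q : Fin n → ℝ) (x : Samples n r) : ℝ :=
  bitsWeight p x.1 * bitsWeight q x.2

/-! ### Success probabilities as finite weighted sums -/

theorem bernWeight_nonneg {a : ℝ} (h₀ : 0 ≤ a) (h₁ : a ≤ 1) (b : Bool) : 0 ≤ bernWeight a b := by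
  unfold bernWeight; split <;> linarith

theorem sum_bernWeight (a : ℝ) : ∑ b, bernWeight a b = 1 := by
  simp [bernWeight]

theorem toReal_bern {a : ℝ} (h₀ : 0 ≤ a) (h₁ : a ≤ 1) (b : Bool) :
    (bern a h₁ b).toReal = bernWeight a b := by
  cases b
  · simp [bern, bernWeight, ENNReal.toReal_sub_of_le, h₀, h₁]
  · simp [bern, bernWeight, h₀]

theorem toReal_bits {n r : ℕ} {a : Fin n → ℝ} (h₀ : ∀ i, 0 ≤ a i) (h₁ : ∀ i, a i ≤ 1)
    (X : Fin n → Fin r → Bool) : (bits r a h₁ X).toReal = bitsWeight a X := by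
  simp [bits, indep, bitsWeight, ENNReal.toReal_prod, toReal_bern, h₀]

theorem bind_bind_pure_prod {α β : Type} [Fintype α] [Fintype β] [DecidableEq α] [DecidableEq β]
    (P : PMF α) (Q : PMF β) (x : α × β) :
    (P.bind fun a => Q.bind fun b => PMF.pure (a, b)) x = P x.1 * Q x.2 := by
  obtain ⟨a, b⟩ := x
  simp [PMF.bind_apply, tsum_fintype, PMF.pure_apply, Prod.ext_iff, ite_and]

theorem toReal_sampleLaw_false {n r : ℕ} (C : Inst n) (x : Samples n r) :
    (sampleLaw C r false x).toReal = sampleWeight C.p C.q x := by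
  simp only [sampleLaw, bind_bind_pure_prod, ENNReal.toReal_mul, sampleWeight]
  rw [toReal_bits fun i => (C.q_nonneg i).trans (C.q_le_p i), toReal_bits C.q_nonneg]

theorem toReal_sampleLaw_true {n r : ℕ} (C : Inst n) (x : Samples n r) :
    (sampleLaw C r true x).toReal = sampleWeight C.q C.p x := by
  simp only [sampleLaw, bind_bind_pure_prod, ENNReal.toReal_mul, sampleWeight]
  rw [toReal_bits fun i => (C.q_nonneg i).trans (C.q_le_p i), toReal_bits C.q_nonneg]

theorem successProb_eq {n : ℕ} (C : Inst n) (A : Algorithm n) (r : ℕ) :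
    successProb C A r =
      (∑ x, sampleWeight C.p C.q x * (A r x false).toReal +
        ∑ x, sampleWeight C.q C.p x * (A r x true).toReal) / 2 := by
  have hmap : ∀ (P : PMF Bool) (B : Bool), (P.map fun guess => guess == B) true = P B := by
    intro P B
    rw [PMF.map_apply, tsum_fintype]
    cases B <;> simp
  have hfin : ∀ B : Bool, ∑ x, sampleLaw C r B x * A r x B ≠ ∞ := fun B =>
    ENNReal.sum_ne_top.2 fun x _ => ENNReal.mul_ne_top (PMF.apply_ne_top _ _) (PMF.apply_ne_top _ _)
  have hB : ∀ B : Bool, (∑ x, sampleLaw C r B x * A r x B).toReal =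
      ∑ x, (sampleLaw C r B x).toReal * (A r x B).toReal := fun B => by
    rw [ENNReal.toReal_sum fun x _ =>
      ENNReal.mul_ne_top (PMF.apply_ne_top _ _) (PMF.apply_ne_top _ _)]
    simp
  unfold successProb
  simp only [PMF.bind_apply, tsum_fintype, hmap, PMF.uniformOfFintype_apply, Fintype.sum_bool,
    Fintype.card_bool]
  rw [ENNReal.toReal_add (ENNReal.mul_ne_top (by simp) (hfin _))
    (ENNReal.mul_ne_top (by simp) (hfin _)), ENNReal.toReal_mul, ENNReal.toReal_mul, hB, hB]
  simp only [toReal_sampleLaw_false, toReal_sampleLaw_true]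
  simp
  ring

theorem sampleWeight_nonneg {n r : ℕ} {p q : Fin n → ℝ} (hp : ∀ i, 0 ≤ p i ∧ p i ≤ 1)
    (hq : ∀ i, 0 ≤ q i ∧ q i ≤ 1) (x : Samples n r) : 0 ≤ sampleWeight p q x :=
  mul_nonneg
    (Finset.prod_nonneg fun i _ => Finset.prod_nonneg fun _ _ =>
      bernWeight_nonneg (hp i).1 (hp i).2 _)
    (Finset.prod_nonneg fun i _ => Finset.prod_nonneg fun _ _ =>
      bernWeight_nonneg (hq i).1 (hq i).2 _)

theorem sampleWeight_swap {n r : ℕ} (p q : Fin n → ℝ) (x : Samples n r) :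
    sampleWeight p q x.swap = sampleWeight q p x := by
  simp [sampleWeight, mul_comm]

theorem sum_sampleWeight_swap {n r : ℕ} (p q : Fin n → ℝ) (F : Samples n r → ℝ) :
    ∑ x, sampleWeight p q x * F x.swap = ∑ x, sampleWeight q p x * F x := by
  rw [← (Equiv.prodComm _ _).sum_comp]
  simp [sampleWeight_swap]

/-! ### Expectations under the product law -/

/-- Independence in the form used below: a sum over arrays of a product over entries factorizes.
Means and probabilities follow by choosing `g` trivial away from the relevant entries. -/
theorem sum_bitsWeight_mul_prod {n r : ℕ} (a : Fin n → ℝ) (g : Fin n → Fin r → Bool → ℝ) :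
    ∑ X, bitsWeight a X * ∏ i, ∏ t, g i t (X i t) =
      ∏ i, ∏ t, ∑ b, bernWeight (a i) b * g i t b := by
  simp only [bitsWeight, ← Finset.prod_mul_distrib]
  rw [← Fintype.prod_sum fun i (f : Fin r → Bool) => ∏ t, bernWeight (a i) (f t) * g i t (f t)]
  refine Finset.prod_congr rfl fun i _ => ?_
  rw [← Fintype.prod_sum fun t b => bernWeight (a i) b * g i t b]

theorem sum_bitsWeight {n : ℕ} (r : ℕ) (a : Fin n → ℝ) :
    ∑ X : Fin n → Fin r → Bool, bitsWeight a X = 1 := by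
  simpa only [mul_one, sum_bernWeight, Finset.prod_const_one] using
    sum_bitsWeight_mul_prod a fun (_ : Fin n) (_ : Fin r) _ => (1 : ℝ)

theorem sum_sampleWeight_fst {n r : ℕ} (p q : Fin n → ℝ) (F : (Fin n → Fin r → Bool) → ℝ) :
    ∑ x : Samples n r, sampleWeight p q x * F x.1 = ∑ X, bitsWeight p X * F X := by
  rw [Fintype.sum_prod_type]
  refine Finset.sum_congr rfl fun X _ => ?_
  simp only [sampleWeight]
  rw [← Finset.sum_mul, ← Finset.mul_sum, sum_bitsWeight, mul_one]

theorem sum_sampleWeight {n : ℕ} (r : ℕ) (p q : Fin n → ℝ) :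
    ∑ x : Samples n r, sampleWeight p q x = 1 := by
  simpa [sum_bitsWeight] using sum_sampleWeight_fst p q fun _ : Fin n → Fin r → Bool => (1 : ℝ)

/-- The mean of a single bit. -/
theorem sum_sampleWeight_mul_bit {n r : ℕ} (p q : Fin n → ℝ) (i : Fin n) (t : Fin r) :
    ∑ x : Samples n r, sampleWeight p q x * (bit (x.1 i t) : ℝ) = p i := by
  rw [sum_sampleWeight_fst p q fun X => (bit (X i t) : ℝ)]
  have key := sum_bitsWeight_mul_prod p
    fun i' (t' : Fin r) b => if i' = i ∧ t' = t then (bit b : ℝ) else 1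
  have hl : ∀ X : Fin n → Fin r → Bool,
      (∏ i', ∏ t', if i' = i ∧ t' = t then (bit (X i' t') : ℝ) else 1) = bit (X i t) := by
    intro X
    rw [Finset.prod_eq_single i, Finset.prod_eq_single t] <;> simp +contextual
  simp only [hl] at key
  rw [key, Finset.prod_eq_single i, Finset.prod_eq_single t] <;>
    simp +contextual [bernWeight, bit]

/-- The probability that the bits `X i t` with `t ∈ T` all vanish. -/
theorem sum_sampleWeight_mul_forall_false {n r : ℕ} (p q : Fin n → ℝ) (i : Fin n)
    (T : Finset (Fin r)) :
    ∑ x : Samples n r, sampleWeight p q x * (if ∀ t ∈ T, x.1 i t = false then 1 else 0) =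
      (1 - p i) ^ T.card := by
  rw [sum_sampleWeight_fst p q fun X => if ∀ t ∈ T, X i t = false then 1 else 0]
  have key := sum_bitsWeight_mul_prod p
    fun i' t' b => if i' = i ∧ t' ∈ T then (if b then 0 else 1) else 1
  have hl : ∀ X : Fin n → Fin r → Bool,
      (∏ i', ∏ t', if i' = i ∧ t' ∈ T then (if X i' t' then (0 : ℝ) else 1) else 1) =
        if ∀ t ∈ T, X i t = false then 1 else 0 := by
    intro X
    rw [Finset.prod_eq_single i]
    · simp only [true_and, Finset.prod_ite_mem, Finset.univ_inter]
      split_ifs with h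
      · exact Finset.prod_eq_one fun t ht => by simp [h t ht]
      · push Not at h
        obtain ⟨t, ht, h⟩ := h
        exact Finset.prod_eq_zero ht (by simp_all)
    · simp +contextual
    · simp
  simp only [hl] at key
  rw [key, Finset.prod_eq_single i]
  · have : ∀ t, ∑ b, bernWeight (p i) b * (if t ∈ T then (if b then 0 else 1) else 1) =
        if t ∈ T then 1 - p i else 1 := by
      intro t
      by_cases h : t ∈ T <;> simp [h, bernWeight]
    simp only [true_and, this, Finset.prod_ite_mem, Finset.univ_inter, Finset.prod_const]
  · intro i' _ h
    simp [h, bernWeight]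
  · simp

/-! ### Symmetries of the sample law -/

/-- Exchange the bits `X i t` and `Y i t` for all `(i, t)` in `M`. -/
def swapOn {n r : ℕ} (M : Finset (Fin n × Fin r)) (x : Samples n r) : Samples n r :=
  (fun i t => if (i, t) ∈ M then x.2 i t else x.1 i t,
    fun i t => if (i, t) ∈ M then x.1 i t else x.2 i t)

theorem swapOn_involutive {n r : ℕ} (M : Finset (Fin n × Fin r)) :
    Function.Involutive (swapOn M) := by
  intro x
  ext i t <;> by_cases h : (i, t) ∈ M <;> simp [swapOn, h]

theorem sampleWeight_eq_prod {n r : ℕ} (p q : Fin n → ℝ) (x : Samples n r) :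
    sampleWeight p q x = ∏ i, ∏ t, bernWeight (p i) (x.1 i t) * bernWeight (q i) (x.2 i t) := by
  simp [sampleWeight, bitsWeight, Finset.prod_mul_distrib]

theorem sampleWeight_swapOn {n r : ℕ} {p q : Fin n → ℝ} {M : Finset (Fin n × Fin r)}
    (hM : ∀ e ∈ M, p e.1 = q e.1) (x : Samples n r) :
    sampleWeight p q (swapOn M x) = sampleWeight p q x := by
  rw [sampleWeight_eq_prod, sampleWeight_eq_prod]
  refine Finset.prod_congr rfl fun i _ => Finset.prod_congr rfl fun t _ => ?_
  by_cases h : (i, t) ∈ M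
  · have := hM _ h
    simp only at this
    simp [swapOn, h, this, mul_comm]
  · simp [swapOn, h]

/-- Flip the bits of `X` in `A.1` and the bits of `Y` in `A.2`; here `(false, i, t)` stands for
`X i t` and `(true, i, t)` for `Y i t`. -/
def flipOn {n r : ℕ} (A : Finset (Bool × Fin n × Fin r)) (x : Samples n r) : Samples n r :=
  (fun i t => xor (x.1 i t) (decide ((false, i, t) ∈ A)),
    fun i t => xor (x.2 i t) (decide ((true, i, t) ∈ A)))

theorem flipOn_involutive {n r : ℕ} (A : Finset (Bool × Fin n × Fin r)) :
    Function.Involutive (flipOn A) := by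
  intro x
  ext i t <;> simp [flipOn]

theorem sampleWeight_flipOn {n r : ℕ} {p q : Fin n → ℝ} {A : Finset (Bool × Fin n × Fin r)}
    (hp : ∀ e ∈ A, p e.2.1 = 1 / 2) (hq : ∀ e ∈ A, q e.2.1 = 1 / 2) (x : Samples n r) :
    sampleWeight p q (flipOn A x) = sampleWeight p q x := by
  have half : ∀ b : Bool, bernWeight (1 / 2) b = 1 / 2 := by
    intro b; unfold bernWeight; split <;> norm_num
  rw [sampleWeight_eq_prod, sampleWeight_eq_prod]
  refine Finset.prod_congr rfl fun i _ => Finset.prod_congr rfl fun t _ => ?_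
  congr 1
  · by_cases h : (false, i, t) ∈ A
    · have := hp _ h
      simp only at this
      rw [this, half, half]
    · simp [flipOn, h]
  · by_cases h : (true, i, t) ∈ A
    · have := hq _ h
      simp only at this
      rw [this, half, half]
    · simp [flipOn, h]

/-- The samples `x`, with `X` and `Y` exchanged if `B` is `true`. -/
def orient {n r : ℕ} (B : Bool) (x : Samples n r) : Samples n r := if B then x.swap else x

/-- The sign `1` or `-1` pointing towards the hidden bit `B`. -/
def orientSign (B : Bool) : ℤ := if B then -1 else 1

/-- The law for `B = 1` is the law for `B = 0` with `X` and `Y` exchanged, so both cases can be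
analysed under the single weight `sampleWeight C.p C.q`. -/
theorem successProb_eq_orient {n : ℕ} (C : Inst n) (A : Algorithm n) (r : ℕ) :
    successProb C A r =
      (∑ x, sampleWeight C.p C.q x * (A r (orient false x) false).toReal +
        ∑ x, sampleWeight C.p C.q x * (A r (orient true x) true).toReal) / 2 := by
  rw [successProb_eq, ← sum_sampleWeight_swap C.p C.q]
  simp [orient]

theorem diffSum_orient {n r : ℕ} (B : Bool) (x : Samples n r) (i : Fin n) :
    diffSum (orient B x) i = orientSign B * diffSum x i := by
  cases B <;> simp [orient, orientSign, diffSum]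

theorem segmentSum_orient {n r : ℕ} (B : Bool) (x : Samples n r) (ℓ : ℕ) (i : Fin n) (j : Fin ℓ) :
    segmentSum (orient B x) ℓ i j = orientSign B * segmentSum x ℓ i j := by
  cases B <;> simp [orient, orientSign, segmentSum]

/-- Reversing the coin as well keeps the sign odd at `d = 0`, where the coin decides. -/
theorem coinSign_neg_not (d : ℤ) (coin : Bool) : coinSign (-d) (!coin) = -coinSign d coin := by
  unfold coinSign
  rcases lt_trichotomy d 0 with h | h | h
  · simp [h, h.not_gt]
  · cases coin <;> simp [h]
  · simp [h, h.not_gt]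

theorem coinSign_eq_or (d : ℤ) (coin : Bool) : coinSign d coin = 1 ∨ coinSign d coin = -1 := by
  unfold coinSign; split_ifs <;> simp

/-! ### Segments and their signs -/

theorem segment_index {r ℓ a b t : ℕ} (ha : a * (r / ℓ) ≤ t ∧ t < (a + 1) * (r / ℓ))
    (hb : b * (r / ℓ) ≤ t ∧ t < (b + 1) * (r / ℓ)) : a = b := by
  rw [← Nat.div_eq_of_lt_le ha.1 ha.2, Nat.div_eq_of_lt_le hb.1 hb.2]

theorem card_segment {r ℓ : ℕ} (j : Fin ℓ) :
    (Finset.univ.filter fun t : Fin r =>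
      j.val * (r / ℓ) ≤ t.val ∧ t.val < (j.val + 1) * (r / ℓ)).card = r / ℓ := by
  have hj : (j.val + 1) * (r / ℓ) ≤ r :=
    (Nat.mul_le_mul_right _ j.isLt).trans (Nat.mul_div_le r ℓ)
  rw [← Finset.card_map Fin.valEmbedding]
  have : (Finset.univ.filter fun t : Fin r =>
      j.val * (r / ℓ) ≤ t.val ∧ t.val < (j.val + 1) * (r / ℓ)).map Fin.valEmbedding =
        Finset.Ico (j.val * (r / ℓ)) ((j.val + 1) * (r / ℓ)) := by
    ext t
    simp only [Finset.mem_map, Finset.mem_filter, Finset.mem_univ, true_and, Finset.mem_Ico,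
      Fin.valEmbedding_apply]
    constructor
    · rintro ⟨t, h, rfl⟩; exact h
    · exact fun h => ⟨⟨t, h.2.trans_le hj⟩, h, rfl⟩
  rw [this, Nat.card_Ico, Nat.add_mul, Nat.one_mul, Nat.add_sub_cancel_left]

/-- The entries of coordinate `i` in the segments of `J`. -/
def segmentEntries {n : ℕ} (r : ℕ) {ℓ : ℕ} (i : Fin n) (J : Finset (Fin ℓ)) :
    Finset (Fin n × Fin r) :=
  Finset.univ.filter fun e => e.1 = i ∧
    ∃ j ∈ J, j.val * (r / ℓ) ≤ e.2.val ∧ e.2.val < (j.val + 1) * (r / ℓ)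

theorem segmentSum_swapOn {n r ℓ : ℕ} (i : Fin n) (J : Finset (Fin ℓ)) (x : Samples n r)
    (j : Fin ℓ) :
    segmentSum (swapOn (segmentEntries r i J) x) ℓ i j =
      if j ∈ J then -segmentSum x ℓ i j else segmentSum x ℓ i j := by
  have h : ∀ t : Fin r, j.val * (r / ℓ) ≤ t.val ∧ t.val < (j.val + 1) * (r / ℓ) →
      ((i, t) ∈ segmentEntries r i J ↔ j ∈ J) := by
    intro t ht
    simp only [segmentEntries, Finset.mem_filter, Finset.mem_univ, true_and]
    constructor
    · rintro ⟨j', hj', h'⟩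
      rwa [Fin.ext (segment_index ht h')]
    · exact fun hj => ⟨j, hj, ht⟩
  unfold segmentSum
  split_ifs with hj
  · rw [← Finset.sum_neg_distrib]
    refine Finset.sum_congr rfl fun t ht => ?_
    have := (h t (Finset.mem_filter.1 ht).2).2 hj
    simp [swapOn, this]
  · refine Finset.sum_congr rfl fun t ht => ?_
    have : (i, t) ∉ segmentEntries r i J := fun h' => hj ((h t (Finset.mem_filter.1 ht).2).1 h')
    simp [swapOn, this]

/-- Flip the coins of the segments in `J`. -/
def flipCoins {n ℓ : ℕ} (J : Finset (Fin ℓ)) (c : Coins n ℓ) : Coins n ℓ :=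
  (fun i j => xor (c.1 i j) (decide (j ∈ J)), c.2)

theorem flipCoins_involutive {n ℓ : ℕ} (J : Finset (Fin ℓ)) :
    Function.Involutive (flipCoins (n := n) J) := by
  intro c
  simp [flipCoins]

/-- The sign `S i j` computed by the coupling algorithm. -/
def segmentSign {n r ℓ : ℕ} (x : Samples n r) (c : Coins n ℓ) (i : Fin n) (j : Fin ℓ) : ℤ :=
  coinSign (segmentSum x ℓ i j) (c.1 i j)

theorem segmentSign_flip {n r ℓ : ℕ} (i : Fin n) (J : Finset (Fin ℓ)) (x : Samples n r)
    (c : Coins n ℓ) (j : Fin ℓ) :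
    segmentSign (swapOn (segmentEntries r i J) x) (flipCoins J c) i j =
      if j ∈ J then -segmentSign x c i j else segmentSign x c i j := by
  unfold segmentSign
  rw [segmentSum_swapOn]
  split_ifs with hj
  · simp [flipCoins, hj, coinSign_neg_not]
  · simp [flipCoins, hj]

/-- A coordinate with `p i = q i` shows any given constant sign in all `ℓ` segments with
probability at most `2 ^ (-ℓ)`. -/
theorem sum_sampleWeight_constant_sign {n r ℓ : ℕ} {p q : Fin n → ℝ}
    (hp : ∀ i, 0 ≤ p i ∧ p i ≤ 1) (hq : ∀ i, 0 ≤ q i ∧ q i ≤ 1) {i : Fin n} (hi : p i = q i)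
    (s : ℤ) :
    (∑ x : Samples n r, sampleWeight p q x *
      ∑ c : Coins n ℓ, if ∀ j, segmentSign x c i j = s then (1 : ℝ) else 0) * 2 ^ ℓ ≤
        Fintype.card (Coins n ℓ) := by
  set F : Samples n r → Coins n ℓ → ℝ := fun x c => if ∀ j, segmentSign x c i j = s then 1 else 0
    with hF
  -- Exchanging `X` and `Y` on coordinate `i` preserves the weight because `p i = q i`, and flipping
  -- coins permutes the uniform coins.
  have inv : ∀ J : Finset (Fin ℓ), ∑ x, sampleWeight p q x * ∑ c, F x c =
      ∑ x, sampleWeight p q x * ∑ c, F (swapOn (segmentEntries r i J) x) (flipCoins J c) := by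
    intro J
    rw [← Equiv.sum_comp (swapOn_involutive (segmentEntries r i J)).toPerm]
    refine Finset.sum_congr rfl fun x _ => ?_
    rw [← Equiv.sum_comp (flipCoins_involutive J).toPerm]
    simp only [Function.Involutive.coe_toPerm]
    rw [sampleWeight_swapOn]
    intro e he
    rw [(Finset.mem_filter.1 he).2.1, hi]
  -- The signs of `x` and `c` determine `J`: it must be exactly the set of segments whose sign
  -- differs from `s`.
  have one : ∀ x c, ∑ J, F (swapOn (segmentEntries r i J) x) (flipCoins J c) ≤ 1 := by
    intro x c
    simp only [hF, segmentSign_flip]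
    rw [Finset.sum_boole]
    norm_cast
    rw [Finset.card_le_one]
    intro J hJ J' hJ'
    simp only [Finset.mem_filter, Finset.mem_univ, true_and] at hJ hJ'
    ext j
    have h := hJ j
    have h' := hJ' j
    have hs := coinSign_eq_or (segmentSum x ℓ i j) (c.1 i j)
    change segmentSign x c i j = 1 ∨ segmentSign x c i j = -1 at hs
    split_ifs at h h' with h₁ h₂ h₂ <;> simp only [h₁, h₂] <;> omega
  calc (∑ x, sampleWeight p q x * ∑ c, F x c) * 2 ^ ℓ
      = ∑ J : Finset (Fin ℓ), ∑ x, sampleWeight p q x *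
          ∑ c, F (swapOn (segmentEntries r i J) x) (flipCoins J c) := by
        rw [← Finset.sum_congr rfl fun J _ => inv J]
        simp [mul_comm]
    _ = ∑ x, sampleWeight p q x *
          ∑ c, ∑ J, F (swapOn (segmentEntries r i J) x) (flipCoins J c) := by
        rw [Finset.sum_comm]
        refine Finset.sum_congr rfl fun x _ => ?_
        rw [← Finset.mul_sum, Finset.sum_comm]
    _ ≤ ∑ x : Samples n r, sampleWeight p q x * ∑ c : Coins n ℓ, 1 :=
        Finset.sum_le_sum fun x _ => mul_le_mul_of_nonneg_left
          (Finset.sum_le_sum fun c _ => one x c) (sampleWeight_nonneg hp hq x)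
    _ = Fintype.card (Coins n ℓ) := by
        rw [← Finset.sum_mul, sum_sampleWeight, one_mul, Finset.sum_const, Finset.card_univ,
          nsmul_eq_mul, mul_one]

/-! ### Success of the coupling algorithm -/

theorem segmentSign_orient_eq {n r ℓ : ℕ} {x : Samples n r} {c : Coins n ℓ} {i : Fin n} {j : Fin ℓ}
    (B : Bool) (h : 0 < segmentSum x ℓ i j) :
    segmentSign (orient B x) c i j = orientSign B := by
  unfold segmentSign
  rw [segmentSum_orient]
  cases B
  · simp [orientSign, coinSign, h]
  · simp [orientSign, coinSign, h, h.not_gt]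

theorem abs_sum_sign_lt {ℓ : ℕ} {S : Fin ℓ → ℤ} (hS : ∀ j, S j = 1 ∨ S j = -1)
    (h₁ : ¬∀ j, S j = 1) (h₂ : ¬∀ j, S j = -1) : |∑ j, S j| < ℓ := by
  push Not at h₁ h₂
  obtain ⟨a, ha⟩ := h₁
  obtain ⟨b, hb⟩ := h₂
  have up : ∑ j, S j < ∑ _j : Fin ℓ, (1 : ℤ) :=
    Finset.sum_lt_sum (fun j _ => by rcases hS j with h | h <;> omega)
      ⟨a, Finset.mem_univ _, by rcases hS a with h | h <;> omega⟩
  have down : ∑ _j : Fin ℓ, (-1 : ℤ) < ∑ j, S j :=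
    Finset.sum_lt_sum (fun j _ => by rcases hS j with h | h <;> omega)
      ⟨b, Finset.mem_univ _, by rcases hS b with h | h <;> omega⟩
  simp only [Finset.sum_const, Finset.card_univ, Fintype.card_fin, smul_neg, nsmul_eq_mul,
    mul_one] at up down
  exact abs_lt.2 ⟨down, up⟩

/-- The coordinate `i₀` attains `|V i₀| = ℓ` and every other one stays strictly below, so no tie
arises and every argmax rule picks `i₀`. As `ℓ ≥ ℓ / 3`, the first branch decides. -/
theorem coupOutput_eq {n r ℓ : ℕ} (τ : ArgmaxRule n) (hℓ : 0 < ℓ) {x : Samples n r}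
    {c : Coins n ℓ} {B : Bool} {i₀ : Fin n} (h₀ : ∀ j, segmentSign x c i₀ j = orientSign B)
    (h : ∀ i, i ≠ i₀ → (¬∀ j, segmentSign x c i j = 1) ∧ ¬∀ j, segmentSign x c i j = -1) :
    coupOutput τ ℓ x c = B := by
  set V : Fin n → ℤ := fun i => ∑ j, segmentSign x c i j with hV
  have hV₀ : V i₀ = ℓ * orientSign B := by simp [hV, h₀]
  have hpick : τ.pick V = i₀ := by
    by_contra hne
    have h1 := τ.isMax V i₀
    have h2 : |V (τ.pick V)| < ℓ := abs_sum_sign_lt (fun j => coinSign_eq_or _ _)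
      (h _ hne).1 (h _ hne).2
    have h3 : |V i₀| = ℓ := by
      rw [hV₀]; cases B <;> simp [orientSign]
    omega
  have hcond : (ℓ : ℝ) / 3 ≤ |((V (τ.pick V) : ℤ) : ℝ)| := by
    rw [hpick, hV₀]
    have : (0 : ℝ) ≤ ℓ := Nat.cast_nonneg _
    cases B <;> simp [orientSign] <;> linarith
  unfold coupOutput
  change (if (ℓ : ℝ) / 3 ≤ |((V (τ.pick V) : ℤ) : ℝ)| then
    (if 0 < V (τ.pick V) then false else true) else _) = B
  rw [if_pos hcond, hpick, hV₀]
  cases B <;> simp [orientSign, hℓ]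

theorem toReal_coupAlg {n : ℕ} (τ : ArgmaxRule n) (α : ℝ) (r : ℕ) (x : Samples n r) (B : Bool) :
    (coupAlg τ α r x B).toReal =
      (∑ c, if coupOutput τ (numSegments n α) x c = B then (1 : ℝ) else 0) /
        Fintype.card (Coins n (numSegments n α)) := by
  unfold coupAlg
  rw [PMF.map_apply, tsum_fintype, ENNReal.toReal_sum, Finset.sum_div]
  · refine Finset.sum_congr rfl fun c _ => ?_
    by_cases h : coupOutput τ (numSegments n α) x c = B
    · simp [h]
    · simp [h, Ne.symm h]
  · intro c _
    split_ifs <;> simp [-Fintype.card_prod]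

theorem snd_eq_false_of_sampleWeight_ne_zero {n r : ℕ} {p q : Fin n → ℝ} {x : Samples n r}
    (hx : sampleWeight p q x ≠ 0) {i : Fin n} (hi : q i = 0) (t : Fin r) : x.2 i t = false := by
  by_contra h
  rw [Bool.not_eq_false] at h
  refine hx ?_
  rw [sampleWeight_eq_prod]
  refine Finset.prod_eq_zero (Finset.mem_univ i) (Finset.prod_eq_zero (Finset.mem_univ t) ?_)
  simp [bernWeight, h, hi]

theorem fst_eq_false_of_sampleWeight_ne_zero {n r : ℕ} {p q : Fin n → ℝ} {x : Samples n r}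
    (hx : sampleWeight p q x ≠ 0) {i : Fin n} (hi : p i = 0) (t : Fin r) : x.1 i t = false := by
  rw [← sampleWeight_swap] at hx
  exact snd_eq_false_of_sampleWeight_ne_zero hx hi t

/-- If coordinate `i₀` has `q = 0` and the others have `p = q`, the coupling algorithm fails only
if `i₀` shows no sample in some segment, or another coordinate has a constant sign. -/
theorem coupAlg_success {n : ℕ} (C : Inst n) (τ : ArgmaxRule n) (α : ℝ) (r : ℕ)
    (hℓ : 0 < numSegments n α) (i₀ : Fin n) (h₀ : C.q i₀ = 0)
    (h : ∀ i, i ≠ i₀ → C.p i = C.q i) :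
    1 - numSegments n α * (1 - C.p i₀) ^ (r / numSegments n α) - n * (2 / 2 ^ numSegments n α) ≤
      successProb C (coupAlg τ α) r := by
  set ℓ := numSegments n α with hdef
  have hp : ∀ i, 0 ≤ C.p i ∧ C.p i ≤ 1 := fun i =>
    ⟨(C.q_nonneg i).trans (C.q_le_p i), C.p_le_one i⟩
  have hq : ∀ i, 0 ≤ C.q i ∧ C.q i ≤ 1 := fun i =>
    ⟨C.q_nonneg i, (C.q_le_p i).trans (C.p_le_one i)⟩
  set N : ℝ := ((Fintype.card (Coins n ℓ) : ℕ) : ℝ) with hN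
  have hNpos : 0 < N := by rw [hN]; exact_mod_cast Fintype.card_pos
  let seg : Fin ℓ → Finset (Fin r) := fun j => Finset.univ.filter fun t : Fin r =>
      j.val * (r / ℓ) ≤ t.val ∧ t.val < (j.val + 1) * (r / ℓ)
  let E : Fin ℓ → Samples n r → ℝ := fun j x => if ∀ t ∈ seg j, x.1 i₀ t = false then 1 else 0
  let G : ℤ → Fin n → Samples n r → Coins n ℓ → ℝ := fun s i x c =>
    if ∀ j, segmentSign x c i j = s then 1 else 0
  suffices key : ∀ B : Bool, 1 - ℓ * (1 - C.p i₀) ^ (r / ℓ) - n * (2 / 2 ^ ℓ) ≤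
      ∑ x, sampleWeight C.p C.q x * (coupAlg τ α r (orient B x) B).toReal by
    rw [successProb_eq_orient]
    linarith [key false, key true]
  intro B
  have hE0 : ∀ j x, 0 ≤ E j x := fun j x => by simp only [E]; split_ifs <;> norm_num
  have hG0 : ∀ s i x c, 0 ≤ G s i x c := fun s i x c => by simp only [G]; split_ifs <;> norm_num
  -- Union bound, sample by sample. Null samples are excluded so that the bits `Y i₀ t` vanish and
  -- one success makes a segment sum positive.
  have pointwise : ∀ x, sampleWeight C.p C.q x ≠ 0 → ∀ c,
      1 - ∑ j, E j x - ∑ i ∈ Finset.univ.erase i₀, (G 1 i (orient B x) c + G (-1) i (orient B x) c)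
        ≤ if coupOutput τ ℓ (orient B x) c = B then (1 : ℝ) else 0 := by
    intro x hx c
    have hsE : 0 ≤ ∑ j, E j x := Finset.sum_nonneg fun j _ => hE0 j x
    have hsG : 0 ≤ ∑ i ∈ Finset.univ.erase i₀,
        (G 1 i (orient B x) c + G (-1) i (orient B x) c) :=
      Finset.sum_nonneg fun i _ => add_nonneg (hG0 _ _ _ _) (hG0 _ _ _ _)
    split_ifs with hout
    · linarith
    by_cases hj : ∃ j, ∀ t ∈ seg j, x.1 i₀ t = false
    · obtain ⟨j, hj⟩ := hj
      have : E j x ≤ ∑ j, E j x :=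
        Finset.single_le_sum (fun j _ => hE0 j x) (Finset.mem_univ j)
      have h1 : E j x = 1 := if_pos hj
      linarith
    by_cases hi : ∃ i ∈ Finset.univ.erase i₀, (∀ j, segmentSign (orient B x) c i j = 1) ∨
        ∀ j, segmentSign (orient B x) c i j = -1
    · obtain ⟨i, hi, hs⟩ := hi
      have := Finset.single_le_sum (f := fun i => G 1 i (orient B x) c + G (-1) i (orient B x) c)
        (fun i _ => add_nonneg (hG0 _ _ _ _) (hG0 _ _ _ _)) hi
      have h1 : 1 ≤ G 1 i (orient B x) c + G (-1) i (orient B x) c := by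
        rcases hs with hs | hs
        · have : G 1 i (orient B x) c = 1 := if_pos hs
          linarith [hG0 (-1) i (orient B x) c]
        · have : G (-1) i (orient B x) c = 1 := if_pos hs
          linarith [hG0 1 i (orient B x) c]
      linarith
    · refine absurd (coupOutput_eq τ hℓ (i₀ := i₀) (fun j => ?_) fun i hne => ?_) hout
      · push Not at hj
        obtain ⟨t, ht, hxt⟩ := hj j
        refine segmentSign_orient_eq B ?_
        unfold segmentSum
        refine Finset.sum_pos' (fun t _ => ?_) ⟨t, ht, ?_⟩
        · rw [snd_eq_false_of_sampleWeight_ne_zero hx h₀]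
          cases x.1 i₀ t <;> simp [bit]
        · rw [snd_eq_false_of_sampleWeight_ne_zero hx h₀]
          simp_all [bit]
      · push Not at hi
        have := hi i (Finset.mem_erase.2 ⟨hne, Finset.mem_univ _⟩)
        push Not
        exact this
  have hEsum : ∑ x, sampleWeight C.p C.q x * ∑ j, E j x = ℓ * (1 - C.p i₀) ^ (r / ℓ) := by
    simp only [Finset.mul_sum]
    rw [Finset.sum_comm]
    simp only [E, sum_sampleWeight_mul_forall_false, seg, card_segment]
    simp
  have hGsum : ∀ i ∈ Finset.univ.erase i₀, ∀ s,
      ∑ x, sampleWeight C.p C.q x * ((∑ c, G s i (orient B x) c) / N) ≤ 1 / 2 ^ ℓ := by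
    intro i hi s
    have hpq := h i (Finset.ne_of_mem_erase hi)
    have hle : (∑ x, sampleWeight C.p C.q x * ∑ c, G s i (orient B x) c) * 2 ^ ℓ ≤ N := by
      cases B
      · exact sum_sampleWeight_constant_sign hp hq hpq s
      -- For `B = true` the exchanged samples have the law with `p` and `q` interchanged, to which
      -- the sign bound applies equally.
      · refine le_trans (le_of_eq ?_) (sum_sampleWeight_constant_sign (r := r) hq hp hpq.symm s)
        congr 1
        exact sum_sampleWeight_swap C.p C.q fun x => ∑ c, G s i x c
    simp only [mul_div_assoc', ← Finset.sum_div]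
    rw [div_le_div_iff₀ hNpos (by positivity)]
    linarith
  calc 1 - ℓ * (1 - C.p i₀) ^ (r / ℓ) - n * (2 / 2 ^ ℓ)
      ≤ 1 - ℓ * (1 - C.p i₀) ^ (r / ℓ) - ∑ i ∈ Finset.univ.erase i₀,
          (∑ x, sampleWeight C.p C.q x * ((∑ c, G 1 i (orient B x) c) / N) +
            ∑ x, sampleWeight C.p C.q x * ((∑ c, G (-1) i (orient B x) c) / N)) := by
        have h1 := Finset.sum_le_sum fun i hi => add_le_add (hGsum i hi 1) (hGsum i hi (-1))
        have h2 : ∑ i ∈ Finset.univ.erase i₀, ((1 : ℝ) / 2 ^ ℓ + 1 / 2 ^ ℓ) ≤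
            ∑ i : Fin n, ((1 : ℝ) / 2 ^ ℓ + 1 / 2 ^ ℓ) :=
          Finset.sum_le_sum_of_subset_of_nonneg (Finset.erase_subset _ _)
            fun _ _ _ => by positivity
        have h3 : ∑ i : Fin n, ((1 : ℝ) / 2 ^ ℓ + 1 / 2 ^ ℓ) = n * (2 / 2 ^ ℓ) := by
          simp; ring
        linarith
    _ = ∑ x, sampleWeight C.p C.q x * ((∑ c, (1 - ∑ j, E j x - ∑ i ∈ Finset.univ.erase i₀,
          (G 1 i (orient B x) c + G (-1) i (orient B x) c))) / N) := by
        rw [← hEsum]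
        have : ∀ x, (∑ c, (1 - ∑ j, E j x - ∑ i ∈ Finset.univ.erase i₀,
            (G 1 i (orient B x) c + G (-1) i (orient B x) c))) / N =
            1 - ∑ j, E j x - ∑ i ∈ Finset.univ.erase i₀,
              ((∑ c, G 1 i (orient B x) c) / N + (∑ c, G (-1) i (orient B x) c) / N) := by
          intro x
          rw [Finset.sum_sub_distrib, Finset.sum_const, Finset.card_univ, nsmul_eq_mul, ← hN,
            sub_div, mul_div_cancel_left₀ _ hNpos.ne', Finset.sum_comm, Finset.sum_div]
          simp only [Finset.sum_add_distrib, add_div]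
        simp only [this]
        simp only [mul_sub, mul_one, Finset.sum_sub_distrib, sum_sampleWeight]
        congr 1
        simp only [← Finset.sum_add_distrib, ← mul_add]
        rw [Finset.sum_comm]
        simp only [Finset.mul_sum]
    _ ≤ ∑ x, sampleWeight C.p C.q x * (coupAlg τ α r (orient B x) B).toReal := by
        refine Finset.sum_le_sum fun x _ => ?_
        by_cases hx : sampleWeight C.p C.q x = 0
        · simp [hx]
        refine mul_le_mul_of_nonneg_left ?_ (sampleWeight_nonneg hp hq x)
        rw [toReal_coupAlg]
        exact div_le_div_of_nonneg_right (Finset.sum_le_sum fun c _ => pointwise x hx c) hNpos.le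

/-! ### Anticoncentration of fair bits -/

/-- A Wallis-type bound, `centralBinom k ≤ 4 ^ k / √(2 k + 1)`. The induction closes because `(2 k +
1) (2 k + 3) ≤ (2 k + 2) ^ 2`. -/
theorem centralBinom_sq_mul_le (k : ℕ) : k.centralBinom ^ 2 * (2 * k + 1) ≤ 16 ^ k := by
  induction k with
  | zero => simp
  | succ k ih =>
    have h := Nat.succ_mul_centralBinom_succ k
    have h2 : (k + 1) ^ 2 * ((k + 1).centralBinom ^ 2 * (2 * (k + 1) + 1)) ≤
        (k + 1) ^ 2 * 16 ^ (k + 1) := by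
      calc (k + 1) ^ 2 * ((k + 1).centralBinom ^ 2 * (2 * (k + 1) + 1))
          = ((k + 1) * (k + 1).centralBinom) ^ 2 * (2 * k + 3) := by ring
        _ = (k.centralBinom ^ 2 * (2 * k + 1)) * (4 * ((2 * k + 1) * (2 * k + 3))) := by
            rw [h]; ring
        _ ≤ 16 ^ k * (4 * (4 * (k + 1) ^ 2)) := by
            refine Nat.mul_le_mul ih (Nat.mul_le_mul_left 4 ?_)
            nlinarith
        _ = (k + 1) ^ 2 * 16 ^ (k + 1) := by ring
    exact Nat.le_of_mul_le_mul_left h2 (by positivity)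

/-- At least about half of the subsets of a `2 k`-element set have fewer than `k - s` elements. -/
theorem four_pow_le_two_mul_card_powerset_filter {α : Type} [DecidableEq α] {K : Finset α} {k : ℕ}
    (hK : K.card = 2 * k) (s : ℕ) :
    4 ^ k ≤ 2 * (K.powerset.filter fun U => U.card + s < k).card +
      (2 * s + 1) * k.centralBinom := by
  -- Split by size into low, high and middle subsets. Complementation maps high into low, and each
  -- of the at most `2 s + 1` middle layers has at most `k.centralBinom` members.
  have hsub : K.powerset ⊆ (K.powerset.filter fun U => U.card + s < k) ∪
      (K.powerset.filter fun U => k + s < U.card) ∪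
        (Finset.Icc (k - s) (k + s)).biUnion fun v => K.powersetCard v := by
    intro U hU
    simp only [Finset.mem_union, Finset.mem_filter, Finset.mem_biUnion, Finset.mem_Icc,
      Finset.mem_powersetCard, hU, true_and, Finset.mem_powerset.1 hU]
    by_cases h1 : U.card + s < k
    · exact Or.inl (Or.inl h1)
    by_cases h2 : k + s < U.card
    · exact Or.inl (Or.inr h2)
    · exact Or.inr ⟨U.card, by omega, rfl⟩
  have hhigh : (K.powerset.filter fun U => k + s < U.card).card ≤
      (K.powerset.filter fun U => U.card + s < k).card := by
    refine Finset.card_le_card_of_injOn (fun U => K \ U) (fun U hU => ?_) fun U hU V hV h => ?_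
    · simp only [Finset.coe_filter, Finset.mem_powerset, Set.mem_ofPred_eq] at hU ⊢
      refine ⟨Finset.sdiff_subset, ?_⟩
      rw [Finset.card_sdiff_of_subset hU.1]
      have := Finset.card_le_card hU.1
      omega
    · simp only [Finset.coe_filter, Finset.mem_powerset, Set.mem_ofPred_eq] at hU hV
      rw [← Finset.sdiff_sdiff_eq_self hU.1, ← Finset.sdiff_sdiff_eq_self hV.1]
      exact congrArg (K \ ·) h
  have hmid : ((Finset.Icc (k - s) (k + s)).biUnion fun v => K.powersetCard v).card ≤
      (2 * s + 1) * k.centralBinom := by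
    refine Finset.card_biUnion_le.trans ?_
    refine (Finset.sum_le_card_nsmul _ _ k.centralBinom fun v _ => ?_).trans ?_
    · rw [Finset.card_powersetCard, hK]
      exact Nat.choose_le_centralBinom v k
    · rw [smul_eq_mul, Nat.card_Icc]
      exact Nat.mul_le_mul_right _ (by omega)
  have := (Finset.card_le_card hsub).trans
    ((Finset.card_union_le _ _).trans (Nat.add_le_add_right (Finset.card_union_le _ _) _))
  rw [Finset.card_powerset, hK, pow_mul] at this
  norm_num at this
  omega

theorem card_powerset_filter_symmDiff {α : Type} [DecidableEq α] {K D : Finset α} (hD : D ⊆ K)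
    (P : Finset α → Prop) [DecidablePred P] :
    (K.powerset.filter fun A => P (symmDiff A D)).card = (K.powerset.filter P).card := by
  have hsub : ∀ {A : Finset α}, A ⊆ K → symmDiff A D ⊆ K := fun hA =>
    symmDiff_le_sup.trans (Finset.union_subset hA hD)
  refine Finset.card_nbij' (symmDiff · D) (symmDiff · D) ?_ ?_ ?_ ?_
  · intro A hA
    simp only [Finset.coe_filter, Finset.mem_powerset, Set.mem_ofPred_eq] at hA ⊢
    exact ⟨hsub hA.1, hA.2⟩
  · intro A hA
    simp only [Finset.coe_filter, Finset.mem_powerset, Set.mem_ofPred_eq] at hA ⊢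
    exact ⟨hsub hA.1, by simpa using hA.2⟩
  · intro A _; simp
  · intro A _; simp

/-- The bits of the coordinates in `I`. -/
def entriesOf {n : ℕ} (r : ℕ) (I : Finset (Fin n)) : Finset (Bool × Fin n × Fin r) :=
  Finset.univ ×ˢ (I ×ˢ Finset.univ)

theorem card_entriesOf {n : ℕ} (r : ℕ) (I : Finset (Fin n)) :
    (entriesOf r I).card = 2 * (I.card * r) := by
  simp [entriesOf]

/-- The entries of `I` where `X` is `1` or `Y` is `0`. -/
def positiveEntries {n r : ℕ} (I : Finset (Fin n)) (x : Samples n r) :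
    Finset (Bool × Fin n × Fin r) :=
  (entriesOf r I).filter fun e => (if e.1 then !x.2 e.2.1 e.2.2 else x.1 e.2.1 e.2.2) = true

theorem positiveEntries_flipOn {n r : ℕ} {I : Finset (Fin n)} {A : Finset (Bool × Fin n × Fin r)}
    (hA : A ⊆ entriesOf r I) (x : Samples n r) :
    positiveEntries I (flipOn A x) = symmDiff A (positiveEntries I x) := by
  ext ⟨b, i, t⟩
  have := @hA (b, i, t)
  simp only [positiveEntries, Finset.mem_symmDiff, Finset.mem_filter, flipOn]
  by_cases hK : (b, i, t) ∈ entriesOf r I <;> by_cases hmem : (b, i, t) ∈ A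
  · cases b <;> simp [hK, hmem]
  · cases b <;> simp [hK, hmem]
  · exact absurd (this hmem) hK
  · simp [hK, hmem]

/-- Writing `-Y` as `(1 - Y) - 1` turns the signed sum into a count of positive entries, centred at
half of the `2 |I| r` entries. -/
theorem sum_diffSum_eq {n r : ℕ} (I : Finset (Fin n)) (x : Samples n r) :
    ∑ i ∈ I, diffSum x i = (positiveEntries I x).card - (I.card * r : ℕ) := by
  have h : ((positiveEntries I x).card : ℤ) =
      ∑ i ∈ I, ∑ t, (bit (x.1 i t) + bit (!x.2 i t)) := by
    rw [positiveEntries, Finset.card_filter, entriesOf, Finset.sum_product]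
    simp only [Finset.sum_product, Fintype.sum_bool]
    push_cast
    simp only [Finset.sum_add_distrib]
    rw [add_comm]
    simp [bit]
  have hb : ∀ b : Bool, bit (!b) = 1 - bit b := by decide
  rw [h]
  have : ((I.card * r : ℕ) : ℤ) = ∑ i ∈ I, ∑ t : Fin r, (1 : ℤ) := by simp
  rw [this, ← Finset.sum_sub_distrib]
  refine Finset.sum_congr rfl fun i _ => ?_
  rw [diffSum, ← Finset.sum_sub_distrib]
  refine Finset.sum_congr rfl fun t _ => ?_
  rw [hb]; ring

/-- The number of ones among the `X i t`. -/
def countOnes {n r : ℕ} (x : Samples n r) (i : Fin n) : ℕ := ∑ t, (x.1 i t).toNat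

theorem sum_sampleWeight_mul_countOnes {n r : ℕ} (p q : Fin n → ℝ) (i : Fin n) :
    ∑ x : Samples n r, sampleWeight p q x * countOnes x i = r * p i := by
  have h : ∀ x : Samples n r, (countOnes x i : ℝ) = ∑ t, (bit (x.1 i t) : ℝ) := by
    intro x
    unfold countOnes
    push_cast
    refine Finset.sum_congr rfl fun t _ => ?_
    cases x.1 i t <;> simp [bit]
  simp only [h, Finset.mul_sum]
  rw [Finset.sum_comm]
  simp [sum_sampleWeight_mul_bit]

/-- With fair bits on the coordinates in `I`, the sum over these coordinates is below minus the
number of ones of `X i₀` with probability close to `1 / 2`. -/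
theorem le_sum_sampleWeight_noise {n r : ℕ} {p q : Fin n → ℝ} (hp : ∀ i, 0 ≤ p i ∧ p i ≤ 1)
    (hq : ∀ i, 0 ≤ q i ∧ q i ≤ 1) {I : Finset (Fin n)} (hpI : ∀ i ∈ I, p i = 1 / 2)
    (hqI : ∀ i ∈ I, q i = 1 / 2) {i₀ : Fin n} (hi₀ : i₀ ∉ I) :
    4 ^ (I.card * r) - (2 * (r * p i₀) + 1) * (I.card * r).centralBinom ≤
      2 * 4 ^ (I.card * r) * ∑ x : Samples n r, sampleWeight p q x *
        (if (positiveEntries I x).card + countOnes x i₀ < I.card * r then 1 else 0) := by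
  set k := I.card * r
  set K := entriesOf r I
  set F : Samples n r → ℝ := fun x =>
    if (positiveEntries I x).card + countOnes x i₀ < k then 1 else 0 with hF
  have hK : K.card = 2 * k := card_entriesOf r I
  have inv : ∀ A ∈ K.powerset, ∑ x, sampleWeight p q x * F x =
      ∑ x, sampleWeight p q x * F (flipOn A x) := by
    intro A hA
    rw [← Equiv.sum_comp (flipOn_involutive A).toPerm]
    refine Finset.sum_congr rfl fun x _ => ?_
    have hmem : ∀ e ∈ A, e.2.1 ∈ I := fun e he => by
      simpa [K, entriesOf] using Finset.mem_powerset.1 hA he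
    simp only [Function.Involutive.coe_toPerm]
    rw [sampleWeight_flipOn (fun e he => hpI _ (hmem e he)) fun e he => hqI _ (hmem e he)]
  -- For fixed `x`, flipping every subset of entries makes the positive set run once through all
  -- subsets of `K`. The ones of `i₀` stay fixed since `i₀ ∉ I`, so the subset count applies with `s
  -- = countOnes x i₀`.
  have avg : ∀ x, (4 ^ k - (2 * countOnes x i₀ + 1) * k.centralBinom : ℝ) ≤
      2 * ∑ A ∈ K.powerset, F (flipOn A x) := by
    intro x
    have hval : ∀ A ∈ K.powerset, F (flipOn A x) =
        if (symmDiff A (positiveEntries I x)).card + countOnes x i₀ < k then 1 else 0 := by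
      intro A hA
      have hA := Finset.mem_powerset.1 hA
      have hc : countOnes (flipOn A x) i₀ = countOnes x i₀ := by
        refine Finset.sum_congr rfl fun t _ => ?_
        have : (false, i₀, t) ∉ A := fun h => hi₀ (by simpa [K, entriesOf] using hA h)
        simp [flipOn, this]
      simp only [hF, hc, positiveEntries_flipOn hA]
    rw [Finset.sum_congr rfl hval, Finset.sum_boole, card_powerset_filter_symmDiff
      (D := positiveEntries I x) (Finset.filter_subset _ _)
      fun U => U.card + countOnes x i₀ < k]
    have := four_pow_le_two_mul_card_powerset_filter hK (countOnes x i₀)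
    have : (4 ^ k : ℝ) ≤ 2 * ((K.powerset.filter fun U => U.card + countOnes x i₀ < k).card : ℝ) +
      (2 * countOnes x i₀ + 1) * k.centralBinom := by exact_mod_cast this
    linarith
  calc (4 ^ k - (2 * (r * p i₀) + 1) * k.centralBinom : ℝ)
      = ∑ x : Samples n r, sampleWeight p q x *
          (4 ^ k - (2 * countOnes x i₀ + 1) * k.centralBinom) := by
        -- The bound is affine in `countOnes`, so only its mean `r * p i₀` enters and no tail
        -- estimate is needed.
        have : ∀ x : Samples n r, sampleWeight p q x *
            (4 ^ k - (2 * countOnes x i₀ + 1) * k.centralBinom) =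
            sampleWeight p q x * (4 ^ k - k.centralBinom) -
              sampleWeight p q x * countOnes x i₀ * (2 * k.centralBinom) := fun x => by ring
        simp only [this, Finset.sum_sub_distrib, ← Finset.sum_mul, sum_sampleWeight,
          sum_sampleWeight_mul_countOnes]
        ring
    _ ≤ ∑ x : Samples n r, sampleWeight p q x * (2 * ∑ A ∈ K.powerset, F (flipOn A x)) :=
        Finset.sum_le_sum fun x _ =>
          mul_le_mul_of_nonneg_left (avg x) (sampleWeight_nonneg hp hq x)
    _ = 2 * ∑ A ∈ K.powerset, ∑ x : Samples n r, sampleWeight p q x * F (flipOn A x) := by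
        rw [Finset.sum_comm, Finset.mul_sum]
        refine Finset.sum_congr rfl fun x _ => ?_
        rw [← Finset.mul_sum]; ring
    _ = 2 * 4 ^ k * ∑ x, sampleWeight p q x * F x := by
        rw [← Finset.sum_congr rfl inv, Finset.sum_const, Finset.card_powerset, hK, pow_mul,
          nsmul_eq_mul]
        push_cast
        ring

/-! ### Failure of counting and of the max algorithm -/

/-- An algorithm that errs whenever the noise of the coordinates in `I` outweighs the information
in `i₀` succeeds with probability below `3 / 4` as long as the noise is strong enough. -/
theorem successProb_lt {n r : ℕ} (C : Inst n) (A : Algorithm n) {I : Finset (Fin n)}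
    (hpI : ∀ i ∈ I, C.p i = 1 / 2) (hqI : ∀ i ∈ I, C.q i = 1 / 2) {i₀ : Fin n} (hi₀ : i₀ ∉ I)
    (h₀ : C.q i₀ = 0)
    (hA : ∀ (B : Bool) (x : Samples n r), sampleWeight C.p C.q x ≠ 0 → 0 ≤ diffSum x i₀ →
      ∑ i ∈ I, diffSum x i + diffSum x i₀ < 0 → A r (orient B x) B = 0)
    (hr : 4 * (2 * (r * C.p i₀) + 1) ^ 2 < 2 * (I.card * r : ℝ) + 1) :
    successProb C A r < 3 / 4 := by
  have hp : ∀ i, 0 ≤ C.p i ∧ C.p i ≤ 1 := fun i =>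
    ⟨(C.q_nonneg i).trans (C.q_le_p i), C.p_le_one i⟩
  have hq : ∀ i, 0 ≤ C.q i ∧ C.q i ≤ 1 := fun i =>
    ⟨C.q_nonneg i, (C.q_le_p i).trans (C.p_le_one i)⟩
  have key := le_sum_sampleWeight_noise (r := r) hp hq hpI hqI hi₀
  set k := I.card * r with hk
  set F : Samples n r → ℝ := fun x =>
    if (positiveEntries I x).card + countOnes x i₀ < k then 1 else 0 with hF
  have hpow : (0 : ℝ) < 4 ^ k := by positivity
  -- Compare squares: `hr` says that the factor before the central binomial coefficient is below
  -- `√(2 k + 1) / 2`. The noise event then has probability above `1 / 4`.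
  have hcb : (2 * (r * C.p i₀) + 1) * k.centralBinom < 4 ^ k / 2 := by
    have h1 : ((k.centralBinom : ℝ)) ^ 2 * (2 * k + 1) ≤ 16 ^ k := by
      exact_mod_cast centralBinom_sq_mul_le k
    have h2 : (16 : ℝ) ^ k = (4 ^ k) ^ 2 := by
      rw [show (16 : ℝ) = 4 ^ 2 by norm_num, ← pow_mul, ← pow_mul, mul_comm]
    have h3 : (0 : ℝ) < k.centralBinom := by exact_mod_cast k.centralBinom_pos
    have hkr : (k : ℝ) = I.card * r := by rw [hk]; push_cast; ring
    refine lt_of_pow_lt_pow_left₀ 2 (by positivity) ?_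
    rw [h2, hkr] at h1
    have := mul_lt_mul_of_pos_left hr (pow_pos h3 2)
    nlinarith
  have hone : 1 / 4 < ∑ x, sampleWeight C.p C.q x * F x := by
    by_contra hle
    have := mul_le_mul_of_nonneg_left (not_lt.1 hle) (mul_nonneg zero_le_two hpow.le)
    linarith
  have hB : ∀ B : Bool, ∑ x, sampleWeight C.p C.q x * (A r (orient B x) B).toReal ≤
      1 - ∑ x, sampleWeight C.p C.q x * F x := by
    intro B
    rw [← sum_sampleWeight r C.p C.q, ← Finset.sum_sub_distrib]
    refine Finset.sum_le_sum fun x _ => ?_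
    by_cases hx : sampleWeight C.p C.q x = 0
    · simp [hx]
    rw [← mul_one_sub]
    refine mul_le_mul_of_nonneg_left ?_ (sampleWeight_nonneg hp hq x)
    simp only [hF]
    split_ifs with hc
    · have hd : diffSum x i₀ = countOnes x i₀ := by
        unfold diffSum countOnes
        push_cast
        refine Finset.sum_congr rfl fun t _ => ?_
        rw [snd_eq_false_of_sampleWeight_ne_zero hx h₀]
        cases x.1 i₀ t <;> simp [bit]
      rw [hA B x hx (by rw [hd]; positivity) (by rw [sum_diffSum_eq, hd]; omega)]
      simp
    · rw [sub_zero]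
      exact ENNReal.toReal_le_of_le_ofReal zero_le_one (by simpa using PMF.coe_le_one _ _)
  rw [successProb_eq_orient]
  linarith [hB false, hB true]

/-- The instance whose coordinate `i₀` has `p = ε` and `q = 0`, while the coordinates in `I` are
fair coins and the remaining ones are constantly `0`. -/
def noisyInst {n : ℕ} (i₀ : Fin n) (I : Finset (Fin n)) (ε : ℝ) (h₀ : 0 ≤ ε) (h₁ : ε ≤ 1) :
    Inst n where
  p i := if i = i₀ then ε else if i ∈ I then 1 / 2 else 0
  q i := if i = i₀ then 0 else if i ∈ I then 1 / 2 else 0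
  q_nonneg i := by split_ifs <;> norm_num
  q_le_p i := by split_ifs <;> simp [h₀]
  p_le_one i := by split_ifs <;> first | assumption | norm_num

theorem signGuess_orientSign_mul {Z : ℤ} (hZ : Z < 0) (B : Bool) :
    signGuess (orientSign B * Z) B = 0 := by
  cases B
  · simp [signGuess, orientSign, hZ, hZ.not_gt]
  · simp [signGuess, orientSign, hZ]

theorem countAlg_successProb_lt {n r : ℕ} {i₀ : Fin n} {ε : ℝ} (h₀ : 0 ≤ ε) (h₁ : ε ≤ 1)
    (hr : 4 * (2 * (r * ε) + 1) ^ 2 < 2 * (((n - 1 : ℕ) : ℝ) * r) + 1) :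
    successProb (noisyInst i₀ (Finset.univ.erase i₀) ε h₀ h₁) (countAlg n) r < 3 / 4 := by
  refine successProb_lt _ _ (I := Finset.univ.erase i₀) (i₀ := i₀) ?_ ?_ (by simp)
    (by simp [noisyInst]) ?_ ?_
  · intro i hi
    simp [noisyInst, Finset.ne_of_mem_erase hi]
  · intro i hi
    simp [noisyInst, Finset.ne_of_mem_erase hi]
  · intro B x _ _ hneg
    unfold countAlg
    simp only [diffSum_orient]
    rw [← Finset.mul_sum, ← Finset.sum_erase_add _ _ (Finset.mem_univ i₀)]
    exact signGuess_orientSign_mul hneg B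
  · simpa [noisyInst, Finset.card_erase_of_mem] using hr

theorem maxAlg_successProb_lt {n r : ℕ} (τ : ArgmaxRule n) {i₀ i₁ : Fin n} (hne : i₁ ≠ i₀) {ε : ℝ}
    (h₀ : 0 ≤ ε) (h₁ : ε ≤ 1) (hr : 4 * (2 * (r * ε) + 1) ^ 2 < 2 * (r : ℝ) + 1) :
    successProb (noisyInst i₀ {i₁} ε h₀ h₁) (maxAlg τ) r < 3 / 4 := by
  refine successProb_lt _ _ (I := {i₁}) (i₀ := i₀) ?_ ?_ (by simpa using hne.symm)
    (by simp [noisyInst]) ?_ ?_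
  · intro i hi
    simp_all [noisyInst]
  · intro i hi
    simp_all [noisyInst]
  · intro B x hx hnonneg hneg
    rw [Finset.sum_singleton] at hneg
    have hzero : ∀ i, i ≠ i₀ → i ≠ i₁ → diffSum x i = 0 := by
      intro i hi hi'
      refine Finset.sum_eq_zero fun t _ => ?_
      rw [snd_eq_false_of_sampleWeight_ne_zero hx (by simp [noisyInst, hi, hi']),
        fst_eq_false_of_sampleWeight_ne_zero hx (by simp [noisyInst, hi, hi'])]
      simp
    have habs : ∀ i, |diffSum (orient B x) i| = |diffSum x i| := by
      intro i
      rw [diffSum_orient, abs_mul]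
      cases B <;> simp [orientSign]
    -- Here `diffSum x i₁ < -diffSum x i₀ ≤ 0`, so `i₁` is strictly larger in absolute value than
    -- `i₀` and the zero coordinates; it is picked and has the wrong sign.
    have hpick : τ.pick (diffSum (orient B x)) = i₁ := by
      by_contra hi
      have h := τ.isMax (diffSum (orient B x)) i₁
      rw [habs, habs, abs_of_neg (by omega)] at h
      by_cases hi0 : τ.pick (diffSum (orient B x)) = i₀
      · rw [hi0, abs_of_nonneg hnonneg] at h
        omega
      · rw [hzero _ hi0 hi, abs_zero] at h
        omega
    unfold maxAlg
    rw [hpick, diffSum_orient]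
    exact signGuess_orientSign_mul (by omega) B
  · simpa [noisyInst] using hr

/-! ### Bounds for `rMin` and choice of parameters -/

/-- The witness is `R = ⌊b⌋₊`; `b < r + 1` expresses `⌊b⌋₊ ≤ r` over the reals. -/
theorem rMin_le_ofReal {n : ℕ} {C : Inst n} {A : Algorithm n} {ρ b : ℝ} (hb : 0 ≤ b)
    (h : ∀ r : ℕ, b < r + 1 → ρ ≤ successProb C A r) : rMin C A ρ ≤ ENNReal.ofReal b := by
  refine (iInf₂_le ⌊b⌋₊ fun r hr => h r ?_).trans ?_
  · exact (Nat.lt_floor_add_one b).trans_le (by exact_mod_cast Nat.add_le_add_right hr 1)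
  · rw [← ENNReal.ofReal_natCast]
    exact ENNReal.ofReal_le_ofReal (Nat.floor_le hb)

/-- One failure at `⌊b⌋₊` suffices: every admissible `R` must exceed it, hence also `b`. -/
theorem ofReal_le_rMin {n : ℕ} {C : Inst n} {A : Algorithm n} {ρ b : ℝ}
    (h : successProb C A ⌊b⌋₊ < ρ) : ENNReal.ofReal b ≤ rMin C A ρ := by
  refine le_iInf₂ fun R hR => ?_
  by_contra hlt
  rw [not_le, ← ENNReal.ofReal_natCast] at hlt
  exact absurd (hR ⌊b⌋₊ (Nat.le_floor (ENNReal.lt_ofReal_iff_toReal_lt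
    ENNReal.ofReal_ne_top |>.1 hlt |>.le.trans' (by simp)))) (not_le.2 h)

theorem rMin_mono {n : ℕ} (C : Inst n) (A : Algorithm n) {ρ ρ' : ℝ} (h : ρ ≤ ρ') :
    rMin C A ρ ≤ rMin C A ρ' :=
  iInf_mono fun _ => iInf_mono' fun hR => ⟨fun r hr => h.trans (hR r hr), le_rfl⟩

theorem numSegments_two_div {n : ℕ} (hn : 0 < n) :
    numSegments n (2 / n) = ⌈36 * Real.logb 2 n⌉₊ := by
  have hn' : (n : ℝ) ≠ 0 := by positivity
  have : 2 * (n : ℝ) / (2 / n) = (n : ℝ) ^ 2 := by field_simp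
  unfold numSegments
  rw [this, Real.logb_pow]
  congr 1
  push_cast
  ring

theorem coupAlg_rMin_le {n : ℕ} (hn : 37 ≤ n) (C : Inst n) (τ : ArgmaxRule n) (i₀ : Fin n)
    (h₀ : C.q i₀ = 0) (h : ∀ i, i ≠ i₀ → C.p i = C.q i) (hpos : 0 < C.p i₀) :
    rMin C (coupAlg τ (2 / (n : ℝ))) (1 - 2 / (n : ℝ)) ≤
      ENNReal.ofReal (5184 * Real.sqrt n * Real.logb 2 n / C.p i₀) := by
  set ε := C.p i₀ with hε
  have hε1 : ε ≤ 1 := C.p_le_one i₀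
  have hn' : (37 : ℝ) ≤ n := by exact_mod_cast hn
  have hn0 : (0 : ℝ) < n := by linarith
  set L := Real.logb 2 n with hL
  have hL1 : 1 ≤ L := by
    rw [hL, Real.le_logb_iff_rpow_le (by norm_num) hn0]
    norm_num; linarith
  have hLn : L ≤ n := by
    rw [hL, Real.logb_le_iff_le_rpow (by norm_num) hn0, Real.rpow_natCast]
    exact_mod_cast (Nat.lt_two_pow_self (n := n)).le
  set ℓ := numSegments n (2 / (n : ℝ)) with hℓ
  have hℓ' : ℓ = ⌈36 * L⌉₊ := numSegments_two_div (by omega)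
  have hℓlo : 36 * L ≤ ℓ := by rw [hℓ']; exact Nat.le_ceil _
  have hℓhi : (ℓ : ℝ) ≤ 37 * L := by
    have := Nat.ceil_lt_add_one (a := 36 * L) (by linarith)
    rw [hℓ']; linarith
  have hℓ0 : (0 : ℝ) < ℓ := by linarith
  have hs0 : 1 ≤ Real.sqrt n := Real.one_le_sqrt.2 (by linarith)
  refine rMin_le_ofReal (by positivity) fun r hr => ?_
  refine le_trans ?_ (coupAlg_success C τ (2 / (n : ℝ)) r (by exact_mod_cast hℓ0) i₀ h₀ h)
  rw [← hℓ, ← hε]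
  set m := r / ℓ with hm
  -- Since `ℓ ≤ 37 L`, `(m + 1) ε` exceeds `5184 / 37 > 140` times `√n`. Removing the extra `ε ≤ 1 ≤
  -- √n` leaves more than `138 √n`.
  have hmε : 138 * Real.sqrt n ≤ m * ε := by
    have h1 : (r : ℝ) + 1 ≤ ℓ * (m + 1) := by
      have : r < ℓ * (m + 1) := Nat.lt_mul_div_succ r (by exact_mod_cast hℓ0)
      exact_mod_cast this
    have h2 : 5184 * Real.sqrt n * L < (r + 1) * ε := by rwa [div_lt_iff₀ hpos] at hr
    have h3 : (ℓ : ℝ) * (m + 1) ≤ 37 * L * (m + 1) :=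
      mul_le_mul_of_nonneg_right hℓhi (by positivity)
    have h4 : 5184 * Real.sqrt n * L < 37 * L * (m + 1) * ε :=
      h2.trans_le (mul_le_mul_of_nonneg_right (h1.trans h3) hpos.le)
    have h5 : 5184 * Real.sqrt n < 37 * (m + 1) * ε := by
      refine lt_of_mul_lt_mul_right ?_ (by linarith : 0 ≤ L)
      linarith
    linarith
  -- The exponent `m ε` far exceeds `3 log n`, as `log n ≤ 2 √n`. So the term is at most `37 n / n ^
  -- 3`, and `37 ≤ n` absorbs the constant.
  have hfirst : ℓ * (1 - ε) ^ m ≤ 1 / n := by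
    have h1 : (1 - ε) ^ m ≤ Real.exp (-(m * ε)) := by
      have := pow_le_pow_left₀ (by linarith) (Real.one_sub_le_exp_neg ε) m
      rwa [← Real.exp_nat_mul, mul_neg] at this
    have hlog : Real.log n ≤ 2 * Real.sqrt n := by
      have h := Real.log_le_sub_one_of_pos (x := Real.sqrt n) (by linarith)
      rw [Real.log_sqrt hn0.le] at h
      linarith
    have h2 : Real.exp (-(m * ε)) ≤ ((n : ℝ) ^ 3)⁻¹ := by
      calc Real.exp (-(m * ε)) ≤ Real.exp (-(3 * Real.log n)) :=
            Real.exp_le_exp.2 (by linarith)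
        _ = ((n : ℝ) ^ 3)⁻¹ := by
            rw [Real.exp_neg, show (3 : ℝ) = ((3 : ℕ) : ℝ) by norm_num, Real.exp_nat_mul,
              Real.exp_log hn0]
    calc ℓ * (1 - ε) ^ m ≤ (37 * n) * ((n : ℝ) ^ 3)⁻¹ :=
          mul_le_mul (by linarith) (h1.trans h2) (pow_nonneg (by linarith) _) (by positivity)
      _ ≤ (n * n) * ((n : ℝ) ^ 3)⁻¹ :=
          mul_le_mul_of_nonneg_right (mul_le_mul_of_nonneg_right hn' hn0.le) (by positivity)
      _ = 1 / n := by field_simp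
  have hsecond : (n : ℝ) * (2 / 2 ^ ℓ) ≤ 1 / n := by
    have h1 : (n : ℝ) ^ 3 ≤ 2 ^ ℓ := by
      calc (n : ℝ) ^ 3 ≤ (n : ℝ) ^ 36 := pow_le_pow_right₀ (by linarith) (by norm_num)
        _ = (2 : ℝ) ^ (36 * L) := by
            rw [mul_comm, Real.rpow_mul (by norm_num), hL,
              Real.rpow_logb (by norm_num) (by norm_num) hn0]
            norm_cast
        _ ≤ (2 : ℝ) ^ (ℓ : ℝ) := Real.rpow_le_rpow_of_exponent_le (by norm_num) hℓlo
        _ = 2 ^ ℓ := Real.rpow_natCast _ _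
    calc (n : ℝ) * (2 / 2 ^ ℓ) ≤ n * (n / n ^ 3) := by gcongr; linarith
      _ = 1 / n := by field_simp
  have : 2 / (n : ℝ) = 1 / n + 1 / n := by ring
  linarith

theorem exists_inst_countAlg {n : ℕ} (hn : 37 ≤ n) {ε : ℝ} (h₀ : 0 < ε) (h₁ : ε ≤ 1) :
    ∃ C : Inst n,
      (∀ τ : ArgmaxRule n, rMin C (coupAlg τ (2 / (n : ℝ))) (1 - 2 / (n : ℝ)) ≤
        ENNReal.ofReal (5184 * Real.sqrt n * Real.logb 2 n / ε)) ∧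
      ENNReal.ofReal ((n : ℝ) / (16 * ε ^ 2)) ≤ rMin C (countAlg n) (3 / 4) := by
  have hn' : (37 : ℝ) ≤ n := by exact_mod_cast hn
  let i₀ : Fin n := ⟨0, by omega⟩
  refine ⟨noisyInst i₀ (Finset.univ.erase i₀) ε h₀.le h₁, fun τ => ?_, ?_⟩
  · refine (coupAlg_rMin_le hn _ τ i₀ (by simp [noisyInst])
      (fun i hi => by simp [noisyInst, hi]) (by simpa [noisyInst] using h₀)).trans ?_
    simp [noisyInst]
  · refine ofReal_le_rMin (countAlg_successProb_lt h₀.le h₁ ?_)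
    set b := (n : ℝ) / (16 * ε ^ 2) with hb
    have hb1 : 1 ≤ b := by
      rw [hb, le_div_iff₀ (by positivity)]
      nlinarith
    have hr1 : (1 : ℝ) ≤ ⌊b⌋₊ := by exact_mod_cast Nat.le_floor (by simpa using hb1)
    have hrb : (⌊b⌋₊ : ℝ) ≤ b := Nat.floor_le (by linarith)
    generalize (⌊b⌋₊ : ℝ) = r at hr1 hrb
    have hrε : 16 * (r * ε ^ 2) ≤ n := by
      rw [hb, le_div_iff₀ (by positivity)] at hrb
      linarith
    -- The square in the goal expands to `16 r² ε² + 16 r ε + 4 ≤ r n + 16 r + 4`, which is below `2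
    -- (n - 1) r + 1` because `37 r ≤ r n` and `r ≥ 1`.
    have hsq : 16 * r ^ 2 * ε ^ 2 ≤ r * n := by nlinarith
    have hrε1 : r * ε ≤ r := mul_le_of_le_one_right (by linarith) h₁
    have hrn : 37 * r ≤ r * n := by nlinarith
    rw [Nat.cast_pred (by omega)]
    nlinarith

theorem exists_inst_maxAlg {n : ℕ} (hn : 37 ≤ n) {ε : ℝ} (h₀ : 0 < ε) (h₁ : ε < 1 / (n : ℝ) ^ 3) :
    ∃ C : Inst n,
      (∀ τ : ArgmaxRule n, rMin C (coupAlg τ (2 / (n : ℝ))) (1 - 2 / (n : ℝ)) ≤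
        ENNReal.ofReal (518400 * Real.sqrt n * Real.log n / ε)) ∧
      ∀ τ : ArgmaxRule n, ENNReal.ofReal (1 / (ε ^ 2 * 2 ^ 14 * Real.log n)) ≤
        rMin C (maxAlg τ) (3 / 4) := by
  have hn' : (37 : ℝ) ≤ n := by exact_mod_cast hn
  have hn0 : (0 : ℝ) < n := by linarith
  have hn3 : (37 : ℝ) ^ 3 ≤ (n : ℝ) ^ 3 := pow_le_pow_left₀ (by norm_num) hn' 3
  have hεn : ε * (n : ℝ) ^ 3 < 1 := by rwa [lt_div_iff₀ (by positivity)] at h₁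
  have hε : ε ≤ 1 / 37 ^ 3 := h₁.le.trans (one_div_le_one_div_of_le (by norm_num) hn3)
  have hε1 : ε ≤ 1 := hε.trans (by norm_num)
  have hlog1 : 1 ≤ Real.log n := by
    rw [Real.le_log_iff_exp_le hn0]
    linarith [Real.exp_one_lt_d9]
  have hlogn : Real.log n ≤ n := (Real.log_le_sub_one_of_pos hn0).trans (by linarith)
  let i₀ : Fin n := ⟨0, by omega⟩
  let i₁ : Fin n := ⟨1, by omega⟩
  have hne : i₁ ≠ i₀ := by simp [i₀, i₁]
  refine ⟨noisyInst i₀ {i₁} ε h₀.le hε1, fun τ => ?_, fun τ => ?_⟩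
  · refine (coupAlg_rMin_le hn _ τ i₀ (by simp [noisyInst])
      (fun i hi => by simp [noisyInst, hi]) (by simpa [noisyInst] using h₀)).trans ?_
    refine ENNReal.ofReal_le_ofReal ?_
    have hlogb : Real.logb 2 n ≤ 100 * Real.log n := by
      rw [Real.logb, div_le_iff₀ (Real.log_pos (by norm_num))]
      nlinarith [Real.log_two_gt_d9]
    have := mul_le_mul_of_nonneg_left hlogb (by positivity : 0 ≤ 5184 * Real.sqrt n)
    simp only [noisyInst, if_true]
    exact div_le_div_of_nonneg_right (by linarith) h₀.le
  · refine ofReal_le_rMin (maxAlg_successProb_lt τ hne h₀.le hε1 ?_)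
    set b := 1 / (ε ^ 2 * 2 ^ 14 * Real.log n) with hb
    -- This uses `ε < 1 / n ^ 3`. It makes `⌊b⌋₊ ≥ 4`, so that `2 r` beats the constant `4` in the
    -- expanded square; the terms with `ε` are tiny multiples of `r`.
    have hb4 : 4 ≤ b := by
      rw [hb, le_div_iff₀ (by positivity)]
      have h1 : ε ^ 2 * Real.log n ≤ (1 / 37 ^ 3) * (1 / 37 ^ 2) := by
        have h2 : ε * n ≤ 1 / 37 ^ 2 := by
          rw [le_div_iff₀ (by norm_num)]
          have : ε * n * 37 ^ 2 ≤ ε * n * n ^ 2 := by gcongr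
          nlinarith
        calc ε ^ 2 * Real.log n ≤ ε ^ 2 * n := by gcongr
          _ = ε * (ε * n) := by ring
          _ ≤ _ := by gcongr
      norm_num at h1 ⊢
      linarith
    have hr4 : (4 : ℝ) ≤ ⌊b⌋₊ := by exact_mod_cast Nat.le_floor (by simpa using hb4)
    have hrb : (⌊b⌋₊ : ℝ) ≤ b := Nat.floor_le (by linarith)
    generalize (⌊b⌋₊ : ℝ) = r at hr4 hrb
    have hrε : r * ε ^ 2 * 2 ^ 14 ≤ 1 := by
      rw [hb, le_div_iff₀ (by positivity)] at hrb
      have : r * ε ^ 2 * 2 ^ 14 * 1 ≤ r * ε ^ 2 * 2 ^ 14 * Real.log n := by gcongr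
      linarith
    have hsq : 16 * (r ^ 2 * ε ^ 2) ≤ r / 2 ^ 10 := by nlinarith
    have hrε1 : r * ε ≤ r * (1 / 37 ^ 3) := by gcongr
    nlinarith

/-- The ratio is at least `(b / a) / ε` when `a > 0`, so a small `ε` defeats any `M`. Running `A'`
at a higher success level `ρ'` only strengthens the upper bound on the optimum. -/
theorem unboundedRatio_of_le {n : ℕ} {A A' : Algorithm n} {ρ ρ' ε₀ a b : ℝ} (hρ : ρ ≤ ρ')
    (hε₀ : 0 < ε₀) (ha : 0 ≤ a) (hb : 0 < b)
    (h : ∀ ε, 0 < ε → ε < ε₀ → ∃ C : Inst n, rMin C A' ρ' ≤ ENNReal.ofReal (a / ε) ∧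
      ENNReal.ofReal (b / ε ^ 2) ≤ rMin C A ρ) : UnboundedRatio A ρ := by
  intro M
  have hM : (0 : ℝ) ≤ M := M.cast_nonneg
  -- The second entry gives `M a ε < b`, that is, `M a / ε < b / ε ^ 2`; the `+ 1` makes this strict
  -- and avoids division by zero.
  set ε := min (ε₀ / 2) (b / (M * a + 1)) with hε
  have hε0 : 0 < ε := lt_min (by positivity) (by positivity)
  obtain ⟨C, h1, h2⟩ := h ε hε0 ((min_le_left _ _).trans_lt (by linarith))
  refine ⟨C, ?_⟩
  have hεb : ε * (M * a + 1) ≤ b := by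
    rw [← le_div_iff₀ (by positivity)]
    exact min_le_right _ _
  calc (M : ℝ≥0∞) * rMinOpt C ρ ≤ M * ENNReal.ofReal (a / ε) := by
        gcongr
        exact (iInf_le _ A').trans ((rMin_mono C A' hρ).trans h1)
    _ = ENNReal.ofReal (M * (a / ε)) := by
        rw [ENNReal.ofReal_mul hM, ENNReal.ofReal_natCast]
    _ < ENNReal.ofReal (b / ε ^ 2) := by
        rw [ENNReal.ofReal_lt_ofReal_iff (by positivity), ← mul_div_assoc,
          div_lt_div_iff₀ hε0 (by positivity)]
        have : M * a * ε < b := by linarith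
        nlinarith
    _ ≤ rMin C A ρ := h2

end Domination

end

theorem mainTheorem11 :
    (∃ N : ℕ, ∀ n : ℕ, N ≤ n → ∀ ε : ℝ, 0 < ε → ε ≤ 1 →
      ∃ C : Domination.Inst n,
        (∀ τ : Domination.ArgmaxRule n,
          Domination.rMin C (Domination.coupAlg τ (2 / (n : ℝ))) (1 - 2 / (n : ℝ)) ≤
            ENNReal.ofReal (5184 * Real.sqrt n * Real.logb 2 n / ε)) ∧
        ENNReal.ofReal ((n : ℝ) / (16 * ε ^ 2)) ≤
          Domination.rMin C (Domination.countAlg n) (3 / 4)) ∧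
    (∃ N : ℕ, ∀ n : ℕ, N ≤ n → ∀ ε : ℝ, 0 < ε → ε < 1 / (n : ℝ) ^ 3 →
      ∃ C : Domination.Inst n,
        (∀ τ : Domination.ArgmaxRule n,
          Domination.rMin C (Domination.coupAlg τ (2 / (n : ℝ))) (1 - 2 / (n : ℝ)) ≤
            ENNReal.ofReal (518400 * Real.sqrt n * Real.log n / ε)) ∧
        (∀ τ : Domination.ArgmaxRule n,
          ENNReal.ofReal (1 / (ε ^ 2 * 2 ^ 14 * Real.log n)) ≤
            Domination.rMin C (Domination.maxAlg τ) (9 / 10))) ∧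
    (∃ N : ℕ, ∀ n : ℕ, N ≤ n →
      Domination.UnboundedRatio (Domination.countAlg n) (3 / 4) ∧
      ∀ τ : Domination.ArgmaxRule n,
        Domination.UnboundedRatio (Domination.maxAlg τ) (3 / 4) ∧
        Domination.UnboundedRatio (Domination.maxAlg τ) (9 / 10)) := by
  refine ⟨⟨37, fun n hn ε h₀ h₁ => Domination.exists_inst_countAlg hn h₀ h₁⟩,
    ⟨37, fun n hn ε h₀ h₁ => ?_⟩, ⟨37, fun n hn => ?_⟩⟩
  · obtain ⟨C, h1, h2⟩ := Domination.exists_inst_maxAlg hn h₀ h₁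
    -- The max algorithm already fails level `3 / 4`, which is stronger than failing `9 / 10`.
    exact ⟨C, h1, fun τ => (h2 τ).trans (Domination.rMin_mono _ _ (by norm_num))⟩
  · have hn' : (37 : ℝ) ≤ n := by exact_mod_cast hn
    have hn0 : (0 : ℝ) < n := by linarith
    have hlog : 0 < Real.log n := Real.log_pos (by linarith)
    have hlogb : 0 < Real.logb 2 n := Real.logb_pos (by norm_num) (by linarith)
    have hρ : (9 / 10 : ℝ) ≤ 1 - 2 / n := by
      have : 2 / (n : ℝ) ≤ 1 / 10 := by rw [div_le_iff₀ hn0]; linarith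
      linarith
    have hmax : ∀ τ : Domination.ArgmaxRule n, ∀ ρ : ℝ, 3 / 4 ≤ ρ → ρ ≤ 1 - 2 / n →
        Domination.UnboundedRatio (Domination.maxAlg τ) ρ := by
      intro τ ρ h34 hρ
      refine Domination.unboundedRatio_of_le (A' := Domination.coupAlg τ (2 / (n : ℝ)))
        (ε₀ := 1 / (n : ℝ) ^ 3)
        (a := 518400 * Real.sqrt n * Real.log n) (b := 1 / (2 ^ 14 * Real.log n)) hρ
        (by positivity) (by positivity) (by positivity) fun ε h₀ h₁ => ?_
      obtain ⟨C, h1, h2⟩ := Domination.exists_inst_maxAlg hn h₀ h₁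
      refine ⟨C, h1 τ, le_trans (le_of_eq ?_) ((h2 τ).trans (Domination.rMin_mono _ _ h34))⟩
      congr 1
      field_simp
    refine ⟨?_, fun τ => ⟨hmax τ _ le_rfl (by linarith), hmax τ _ (by norm_num) hρ⟩⟩
    -- Counting involves no tie-breaking, but the coupling algorithm used as competitor needs some
    -- argmax rule, which requires a coordinate to exist.
    have : NeZero n := ⟨by omega⟩
    obtain ⟨τ⟩ := Domination.nonempty_argmaxRule n
    refine Domination.unboundedRatio_of_le (A' := Domination.coupAlg τ (2 / (n : ℝ)))
      (ε₀ := 1) (a := 5184 * Real.sqrt n * Real.logb 2 n)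
      (b := n / 16) (by linarith : (3 / 4 : ℝ) ≤ 1 - 2 / n)
      (by positivity) (by positivity) (by positivity) fun ε h₀ h₁ => ?_
    obtain ⟨C, h1, h2⟩ := Domination.exists_inst_countAlg hn h₀ h₁.le
    refine ⟨C, h1 τ, le_trans (le_of_eq ?_) h2⟩
    congr 1
    field_simp
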